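/- Let $j\in\{0,\tfrac12,1,\tfrac32,\dots\}$, let $\mathcal H_j\cong\mathbb C^{2j+1}$ be the Hilbert space of a spin-$j$ system with orthonormal basis $|j,m\rangle$, $m=j,j-1,\dots,-j$, let $J_x,J_y,J_z$ be the angular momentum operators on $\mathcal H_j$ (so $J_z|j,m\rangle=m|j,m\rangle$ and $(J_x\pm iJ_y)|j,m\rangle=\sqrt{j(j+1)-m(m\pm1)}\,|j,m\pm1\rangle$), and let $R_j$ be the spin-$j$ irreducible representation of $SU(2)$ on $\mathcal H_j$ that they generate. Define $$\zeta(\rho)=\frac1{j(j+1)}\sum_{k\in\{x,y,z\}}J_k\,\rho\,J_k ,$$ let $\zeta^{\circ n}$ be its $n$-fold composition and $\zeta^{\circ0}=\mathrm{id}$ (for $j=0$ only $\zeta^{\circ 0}$ is used below). Let $\xi$ be a complex-linear map on the operators on $\mathcal H_j$ that is covariant under $R_j$, i.e. $\xi\big(R_j(g)\rho R_j(g)^{-1}\big)=R_j(g)\,\xi(\rho)\,R_j(g)^{-1}$ for all $g\in SU(2)$ and all operators $\rho$. Then $$\xi=\sum_{n=0}^{2j}q_n\,\zeta^{\circ n}$$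 for some complex coefficients $q_n$. If moreover $\xi(\rho)$ is Hermitian for every density operator $\rho$ (in particular, if $\xi$ is a positive map), then $\xi$ has this form with real coefficients $q_n$. -/

import Mathlib

open scoped Matrix ComplexOrder

noncomputable section

/-- The group `SU(2)`. -/
abbrev SU2 : Type := Matrix.specialUnitaryGroup (Fin 2) ℂ

/-- Operators on the Hilbert space of a spin-`j` system, where `N = 2j`, written as matrices in the
orthonormal basis `|j, m⟩`. The index `k = 0, …, 2j` stands for `m = j - k`. -/
abbrev SpinOp (N : ℕ) : Type := Matrix (Fin (N + 1)) (Fin (N + 1)) ℂ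

/-- The spin `j = N / 2`. -/
def spin (N : ℕ) : ℝ := N / 2

/-- The magnetic quantum number `m = j - k` of the basis vector of index `k`. -/
def magnetic (N : ℕ) (k : Fin (N + 1)) : ℝ := spin N - (k : ℕ)

/-- The raising operator: `J₊ |j, m⟩ = √(j (j + 1) - m (m + 1)) |j, m + 1⟩`. -/
def Jplus (N : ℕ) : SpinOp N := Matrix.of fun a b =>
  if (a : ℕ) + 1 = (b : ℕ) then
    ((Real.sqrt (spin N * (spin N + 1) - magnetic N b * (magnetic N b + 1)) : ℝ) : ℂ)
  else 0

/-- The lowering operator `J₋ = J₊†`. -/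
def Jminus (N : ℕ) : SpinOp N := (Jplus N)ᴴ

/-- The angular momentum operators `J_x, J_y, J_z` of a spin-`N / 2` system, where
`J₊ = J_x + i J_y`, `J₋ = J_x - i J_y` and `J_z |j, m⟩ = m |j, m⟩`. -/
def angMom (N : ℕ) : Fin 3 → SpinOp N :=
  ![(1 / 2 : ℂ) • (Jplus N + Jminus N),
    (1 / (2 * Complex.I) : ℂ) • (Jplus N - Jminus N),
    Matrix.diagonal fun k => (magnetic N k : ℂ)]

/-- The map `ζ(ρ) = (1 / (j (j + 1))) ∑_k J_k ρ J_k`. -/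
def zetaMap (N : ℕ) : Module.End ℂ (SpinOp N) :=
  (((1 / (spin N * (spin N + 1)) : ℝ)) : ℂ) •
    ∑ k : Fin 3, LinearMap.mulLeft ℂ (angMom N k) ∘ₗ LinearMap.mulRight ℂ (angMom N k)

/-- The polynomial `(a + c X) ^ (N - k) * (b + d X) ^ k` for a matrix with rows `(a, b)`, `(c, d)`:
the image of `e₁ ^ (N - k) * e₂ ^ k` in the `N`-th symmetric power of `ℂ²` under the matrix,
dehomogenized by `e₁ = 1`, `e₂ = X`. -/
def symImage (N : ℕ) (U : Matrix (Fin 2) (Fin 2) ℂ) (k : ℕ) : Polynomial ℂ :=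
  (Polynomial.C (U 0 0) + Polynomial.C (U 1 0) * Polynomial.X) ^ (N - k) *
    (Polynomial.C (U 0 1) + Polynomial.C (U 1 1) * Polynomial.X) ^ k

/-- The matrix of the `N`-th symmetric power of a `2 × 2` matrix in the orthonormal basis
`√(N choose k) e₁ ^ (N - k) e₂ ^ k`, `k = 0, …, N`. -/
def symPow (N : ℕ) (U : Matrix (Fin 2) (Fin 2) ℂ) : SpinOp N := Matrix.of fun l k =>
  ((Real.sqrt (N.choose k) / Real.sqrt (N.choose l) : ℝ) : ℂ) * (symImage N U k).coeff l

theorem natDegree_linear_le (a c : ℂ) :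
    (Polynomial.C a + Polynomial.C c * Polynomial.X).natDegree ≤ 1 := by
  rw [add_comm]; exact Polynomial.natDegree_linear_le

theorem natDegree_symImage_le {N k : ℕ} (hk : k ≤ N) (U : Matrix (Fin 2) (Fin 2) ℂ) :
    (symImage N U k).natDegree ≤ N := by
  refine Polynomial.natDegree_mul_le.trans ?_
  have h1 := Polynomial.natDegree_pow_le_of_le (N - k) (natDegree_linear_le (U 0 0) (U 1 0))
  have h2 := Polynomial.natDegree_pow_le_of_le k (natDegree_linear_le (U 0 1) (U 1 1))
  omega

theorem symImage_one {N k : ℕ} : symImage N 1 k = Polynomial.X ^ k := by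
  simp [symImage]

theorem homogenize_pow' (p : Polynomial ℂ) (hp : p.natDegree ≤ 1) (n : ℕ) :
    (p ^ n).homogenize n = (p.homogenize 1) ^ n := by
  induction n with
  | zero => simp
  | succ n ih =>
    rw [pow_succ, Polynomial.homogenize_mul _ _ _ hp, ih, pow_succ]
    simpa using Polynomial.natDegree_pow_le_of_le n hp

theorem aeval_homogenize_linear (a c : ℂ) (f : Fin 2 → Polynomial ℂ) :
    MvPolynomial.aeval f ((Polynomial.C a + Polynomial.C c * Polynomial.X).homogenize 1) =
      Polynomial.C a * f 1 + Polynomial.C c * f 0 := by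
  rw [Polynomial.homogenize_add, Polynomial.homogenize_C_mul, Polynomial.homogenize_C,
    Polynomial.homogenize_X one_ne_zero]
  simp [Polynomial.C_eq_algebraMap]

/-- The symmetric power action is a homomorphism, on the level of basis vectors. -/
theorem symImage_mul {N k : ℕ} (hk : k ≤ N) (U V : Matrix (Fin 2) (Fin 2) ℂ) :
    symImage N (U * V) k =
      ∑ l ∈ Finset.range (N + 1), Polynomial.C ((symImage N V k).coeff l) * symImage N U l := by
  set f : Fin 2 → Polynomial ℂ :=
    ![Polynomial.C (U 0 1) + Polynomial.C (U 1 1) * Polynomial.X,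
      Polynomial.C (U 0 0) + Polynomial.C (U 1 0) * Polynomial.X] with hf
  have key1 : MvPolynomial.aeval f ((symImage N V k).homogenize N) = symImage N (U * V) k := by
    have hN : N = (N - k) + k := by omega
    have h1 := Polynomial.natDegree_pow_le_of_le (N - k) (natDegree_linear_le (V 0 0) (V 1 0))
    have h2 := Polynomial.natDegree_pow_le_of_le k (natDegree_linear_le (V 0 1) (V 1 1))
    rw [mul_one] at h1 h2
    have h3 : (symImage N V k).homogenize N = (symImage N V k).homogenize ((N - k) + k) := by
      rw [← hN]
    rw [h3, symImage, Polynomial.homogenize_mul _ _ h1 h2,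
      homogenize_pow' _ (natDegree_linear_le _ _), homogenize_pow' _ (natDegree_linear_le _ _),
      map_mul, map_pow, map_pow, aeval_homogenize_linear, aeval_homogenize_linear, symImage]
    congr 2
    · simp [hf, Matrix.mul_apply, Fin.sum_univ_two]; ring
    · simp [hf, Matrix.mul_apply, Fin.sum_univ_two]; ring
  rw [← key1]
  conv_lhs => rw [Polynomial.as_sum_range' (symImage N V k) (N + 1)
    (Nat.lt_succ_of_le (natDegree_symImage_le hk V))]
  rw [Polynomial.homogenize_finsetSum, map_sum]
  refine Finset.sum_congr rfl fun l hl => ?_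
  have hl' : l ≤ N := by simpa [Nat.lt_succ_iff] using hl
  rw [← Polynomial.C_mul_X_pow_eq_monomial, Polynomial.homogenize_C_mul,
    Polynomial.homogenize_X_pow hl', map_mul, map_mul, map_pow, map_pow]
  simp [hf, symImage, Polynomial.C_eq_algebraMap, mul_comm]

theorem symPow_one (N : ℕ) : symPow N 1 = 1 := by
  ext l k
  have hpos : ∀ i : Fin (N + 1), Real.sqrt (N.choose i) ≠ 0 := fun i =>
    (Real.sqrt_pos.2 (by exact_mod_cast Nat.choose_pos (Nat.lt_succ_iff.1 i.2))).ne'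
  by_cases h : l = k
  · subst h
    simp [symPow, symImage_one, hpos l]
  · have h' : (l : ℕ) ≠ k := fun e => h (Fin.ext e)
    simp [symPow, symImage_one, Polynomial.coeff_X_pow, h, h']

theorem symPow_mul (N : ℕ) (U V : Matrix (Fin 2) (Fin 2) ℂ) :
    symPow N (U * V) = symPow N U * symPow N V := by
  have hpos : ∀ i : Fin (N + 1), ((Real.sqrt (N.choose i) : ℝ) : ℂ) ≠ 0 := fun i =>
    Complex.ofReal_ne_zero.2
      (Real.sqrt_pos.2 (by exact_mod_cast Nat.choose_pos (Nat.lt_succ_iff.1 i.2))).ne'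
  ext l k
  rw [Matrix.mul_apply]
  simp only [symPow, Matrix.of_apply]
  rw [symImage_mul (Nat.lt_succ_iff.1 k.2), Polynomial.finsetSum_coeff, Finset.mul_sum,
    ← Fin.sum_univ_eq_sum_range fun i => ((Real.sqrt (N.choose k) / Real.sqrt (N.choose l) : ℝ) : ℂ)
      * (Polynomial.C ((symImage N V k).coeff i) * symImage N U i).coeff l]
  refine Finset.sum_congr rfl fun i _ => ?_
  rw [Polynomial.coeff_C_mul]
  push_cast
  have := hpos i
  have := hpos l
  field_simp

/-- The spin-`N / 2` irreducible representation `R_j` of `SU(2)`: the `N`-th symmetric power of the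
defining representation, in the orthonormal basis `|j, m⟩`. It is generated by `angMom N`. -/
def spinRep (N : ℕ) : SU2 →* SpinOp N where
  toFun g := symPow N (g : Matrix (Fin 2) (Fin 2) ℂ)
  map_one' := symPow_one N
  map_mul' g h := symPow_mul N g h

/-- Invariance (covariance) of a map on operators of the spin-`N / 2` system under `SU(2)`:
`ξ (R_j(g) ρ R_j(g)⁻¹) = R_j(g) ξ(ρ) R_j(g)⁻¹` for all `g` in `SU(2)` and all operators `ρ`. -/
def IsSU2Covariant (N : ℕ) (ξ : Module.End ℂ (SpinOp N)) : Prop :=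
  ∀ (g : SU2) (ρ : SpinOp N),
    ξ (spinRep N g * ρ * spinRep N g⁻¹) = spinRep N g * ξ ρ * spinRep N g⁻¹

/-- Density matrices: positive semidefinite of trace one. -/
def IsDensityMatrix {N : ℕ} (ρ : SpinOp N) : Prop :=
  ρ.PosSemidef ∧ ρ.trace = 1

end

/-!
A covariant map `ξ` is determined by the single operator `ξ(|j, j⟩⟨j, j|)`. Indeed the conjugates of
`|j, j⟩⟨j, j|` under `SU(2)` are the coherent state projections, whose matrix entries are, up to
normalization, the monomials `z ^ l * conj z ^ k` times nonzero constants; these monomials are linearly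
independent, so the coherent states span all operators (`IsSU2Covariant.eq_zero`). Moreover
`ξ(|j, j⟩⟨j, j|)` is diagonal, because `|j, j⟩⟨j, j|` is invariant under rotations about the `z` axis
(`IsSU2Covariant.apply_single_offDiag`).

The map `ζ` is itself covariant (`isSU2Covariant_zetaMap`). It sends `|j, m⟩⟨j, m|` to a real
combination of the projections with magnetic numbers `m + 1`, `m`, `m - 1`, with a nonzero coefficient
at `m - 1` unless `m = -j` (`zetaMap_basisProj`). Hence `ζ^n(|j, j⟩⟨j, j|)`, `n = 0, …, 2j`, is a basis
of the diagonal operators, triangular and real with respect to the projections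
(`exists_aeval_zetaMap_eq_basisProj`). Expanding `ξ(|j, j⟩⟨j, j|)` in this basis gives coefficients
`q_n` for which `ξ` and `∑ q_n ζ^n` agree at `|j, j⟩⟨j, j|`, and so everywhere. As `|j, j⟩⟨j, j|` is a
density operator, `ξ(|j, j⟩⟨j, j|)` is Hermitian in the second part, its diagonal is real, and the
`q_n` are real.

Covariance of `ζ` holds for group elements, not only infinitesimally: with `D` the derivative of the
symmetric power at the identity, `∑ J_k ρ J_k = ½ ∑ D(e_ab) ρ D(e_ba) - ¼ N² ρ`, the tensor
`∑ e_ab ⊗ e_ba` is invariant under conjugation, and `R(g) D(Y) R(g)⁻¹ = D(g Y g⁻¹)`.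
-/

noncomputable section

/-! ### Polynomials in a complex number and its conjugate -/

open Polynomial in
theorem Polynomial.eq_zero_of_eval_ofReal_eq_zero (p : ℂ[X]) (h : ∀ x : ℝ, p.eval (x : ℂ) = 0) :
    p = 0 :=
  p.eq_zero_of_infinite_isRoot <|
    (Set.infinite_range_of_injective Complex.ofReal_injective).mono <| by
      rintro _ ⟨x, rfl⟩
      exact h x

open Polynomial in
theorem eq_zero_of_forall_sum_mul_pow_eq_zero {n : ℕ} (c : Fin n → ℂ)
    (h : ∀ x : ℂ, ∑ k : Fin n, c k * x ^ (k : ℕ) = 0) (k : Fin n) : c k = 0 := by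
  have hp : (∑ k : Fin n, C (c k) * X ^ (k : ℕ) : ℂ[X]) = 0 :=
    Polynomial.funext fun x => by simpa [eval_finsetSum] using h x
  have := congrArg (fun p => coeff p (k : ℕ)) hp
  simpa [finsetSum_coeff, coeff_X_pow, Fin.val_inj] using this

open Polynomial in
/-- The monomials `z ^ l * conj z ^ k` are linearly independent: a relation that holds at `z = x + iy`
for real `x` and `y` extends to complex `x` and `y`, where `x + iy` and `x - iy` are independent. -/
theorem eq_zero_of_forall_sum_mul_pow_mul_conj_pow_eq_zero {n : ℕ} (c : Fin n → Fin n → ℂ)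
    (h : ∀ z : ℂ, ∑ l : Fin n, ∑ k : Fin n,
      c l k * (z ^ (l : ℕ) * (starRingEnd ℂ z) ^ (k : ℕ)) = 0) (l k : Fin n) : c l k = 0 := by
  have h1 (y : ℝ) (x : ℂ) : ∑ l : Fin n, ∑ k : Fin n,
      c l k * ((x + y * Complex.I) ^ (l : ℕ) * (x - y * Complex.I) ^ (k : ℕ)) = 0 := by
    have hp := Polynomial.eq_zero_of_eval_ofReal_eq_zero (∑ l : Fin n, ∑ k : Fin n,
      C (c l k) * ((X + C (y * Complex.I)) ^ (l : ℕ) * (X - C (y * Complex.I)) ^ (k : ℕ)))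
      fun x => by simpa [eval_finsetSum, sub_eq_add_neg] using h (x + y * Complex.I)
    simpa [eval_finsetSum] using congrArg (eval x) hp
  have h2 (x y : ℂ) : ∑ l : Fin n, ∑ k : Fin n,
      c l k * ((x + y * Complex.I) ^ (l : ℕ) * (x - y * Complex.I) ^ (k : ℕ)) = 0 := by
    have hp := Polynomial.eq_zero_of_eval_ofReal_eq_zero (∑ l : Fin n, ∑ k : Fin n,
      C (c l k) * ((C x + X * C Complex.I) ^ (l : ℕ) * (C x - X * C Complex.I) ^ (k : ℕ)))
      fun y => by
        simpa only [eval_finsetSum, eval_mul, eval_pow, eval_add, eval_sub, eval_C, eval_X]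
          using h1 y x
    simpa only [eval_finsetSum, eval_mul, eval_pow, eval_add, eval_sub, eval_C, eval_X, eval_zero]
      using congrArg (eval y) hp
  have h3 (s t : ℂ) : ∑ l : Fin n, ∑ k : Fin n, c l k * (s ^ (l : ℕ) * t ^ (k : ℕ)) = 0 := by
    have := h2 ((s + t) / 2) ((s - t) / 2 * -Complex.I)
    have e : (s - t) / 2 * -Complex.I * Complex.I = (s - t) / 2 := by
      linear_combination (-(s - t) / 2) * Complex.I_mul_I
    have e1 : (s + t) / 2 + (s - t) / 2 = s := by ring
    have e2 : (s + t) / 2 - (s - t) / 2 = t := by ring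
    rwa [e, e1, e2] at this
  refine eq_zero_of_forall_sum_mul_pow_eq_zero (c l) (fun t => ?_) k
  refine eq_zero_of_forall_sum_mul_pow_eq_zero (fun l => ∑ k : Fin n, c l k * t ^ (k : ℕ))
    (fun s => ?_) l
  rw [← h3 s t]
  refine Finset.sum_congr rfl fun l _ => ?_
  rw [Finset.sum_mul]
  exact Finset.sum_congr rfl fun k _ => by ring

/-! ### Coherent states -/

/-- `√(N choose k)`, the norm of `e₁ ^ (N - k) * e₂ ^ k`, is nonzero. -/
theorem sqrt_choose_ne_zero {N : ℕ} (k : Fin (N + 1)) :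
    ((Real.sqrt (N.choose k) : ℝ) : ℂ) ≠ 0 :=
  Complex.ofReal_ne_zero.2
    (Real.sqrt_pos.2 (by exact_mod_cast Nat.choose_pos (Nat.lt_succ_iff.1 k.2))).ne'

open Polynomial in
theorem symPow_apply_zero (N : ℕ) (U : Matrix (Fin 2) (Fin 2) ℂ) (l : Fin (N + 1)) :
    symPow N U l 0 = ((Real.sqrt (N.choose l) : ℝ) : ℂ) * (U 0 0 ^ (N - l) * U 1 0 ^ (l : ℕ)) := by
  have hs : ((Real.sqrt (N.choose l) : ℝ) : ℂ) * ((Real.sqrt (N.choose l) : ℝ) : ℂ)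
      = (N.choose l : ℂ) := by
    rw [← Complex.ofReal_mul, Real.mul_self_sqrt (Nat.cast_nonneg _), Complex.ofReal_natCast]
  have hne := sqrt_choose_ne_zero l
  have hc : ((C (U 0 0) + C (U 1 0) * X : ℂ[X]) ^ N).coeff l =
      U 0 0 ^ (N - l) * U 1 0 ^ (l : ℕ) * N.choose l := by
    rw [add_comm, add_pow, finsetSum_coeff, Finset.sum_eq_single (l : ℕ)]
    · rw [mul_pow, ← C_pow, ← C_pow, mul_assoc, mul_assoc, coeff_C_mul, ← C_eq_natCast, ← C_mul,
        mul_comm (X ^ (l : ℕ)), coeff_C_mul, coeff_X_pow]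
      simp; ring
    · intro m _ hm
      rw [mul_pow, ← C_pow, ← C_pow, mul_assoc, mul_assoc, coeff_C_mul, ← C_eq_natCast, ← C_mul,
        mul_comm (X ^ m), coeff_C_mul, coeff_X_pow, if_neg hm.symm]
      simp
    · intro h
      exact absurd (Finset.mem_range.2 l.2) h
  simp only [symPow, symImage, Matrix.of_apply, Fin.val_zero, Nat.sub_zero, pow_zero, mul_one, hc]
  rw [← hs]
  simp only [Nat.choose_zero_right, Nat.cast_one, Real.sqrt_one, one_div, Complex.ofReal_inv]
  field_simp

open Polynomial in
theorem symPow_zero_apply (N : ℕ) (U : Matrix (Fin 2) (Fin 2) ℂ) (k : Fin (N + 1)) :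
    symPow N U 0 k = ((Real.sqrt (N.choose k) : ℝ) : ℂ) * (U 0 0 ^ (N - k) * U 0 1 ^ (k : ℕ)) := by
  simp [symPow, symImage, coeff_zero_eq_eval_zero]

/-- The element of `SU(2)` that sends `e₁` to the normalization of `e₁ + z e₂`. -/
def coherentRotation (z : ℂ) : SU2 :=
  ⟨((Real.sqrt (1 + ‖z‖ ^ 2))⁻¹ : ℂ) • !![1, -starRingEnd ℂ z; z, 1], by
    have h0 : (0 : ℝ) < 1 + ‖z‖ ^ 2 := by positivity
    have hs : ((Real.sqrt (1 + ‖z‖ ^ 2) : ℝ) : ℂ) * ((Real.sqrt (1 + ‖z‖ ^ 2) : ℝ) : ℂ)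
        = 1 + z * starRingEnd ℂ z := by
      rw [← Complex.ofReal_mul, Real.mul_self_sqrt h0.le, Complex.mul_conj']
      push_cast; rfl
    have hne : ((Real.sqrt (1 + ‖z‖ ^ 2) : ℝ) : ℂ) ≠ 0 :=
      Complex.ofReal_ne_zero.2 (Real.sqrt_pos.2 h0).ne'
    rw [Matrix.mem_specialUnitaryGroup_iff, Matrix.mem_unitaryGroup_iff]
    constructor
    · ext i j
      fin_cases i <;> fin_cases j <;>
        simp [Matrix.mul_apply, Fin.sum_univ_two, Matrix.star_apply] <;> field_simp <;>
        (try rw [sq, hs]) <;> ring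
    · rw [Matrix.det_fin_two]
      simp
      field_simp
      rw [sq, hs]; ring⟩

/-- The coherent state projections, as polynomials in `z` and its conjugate up to normalization. -/
theorem spinRep_coherentRotation_conj_single (N : ℕ) (z : ℂ) :
    spinRep N (coherentRotation z) * (Matrix.single 0 0 1 : SpinOp N) * spinRep N (coherentRotation z)⁻¹ =
      (((Real.sqrt (1 + ‖z‖ ^ 2))⁻¹ : ℂ) ^ (2 * N)) • ∑ l : Fin (N + 1), ∑ k : Fin (N + 1),
        (z ^ (l : ℕ) * (starRingEnd ℂ z) ^ (k : ℕ)) •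
          Matrix.single l k (((Real.sqrt (N.choose l) : ℝ) : ℂ) * (Real.sqrt (N.choose k) : ℝ)) := by
  ext l k
  have e : (spinRep N (coherentRotation z) * (Matrix.single 0 0 1 : SpinOp N) *
      spinRep N (coherentRotation z)⁻¹) l k =
      spinRep N (coherentRotation z) l 0 * spinRep N (coherentRotation z)⁻¹ 0 k := by
    simp [Matrix.mul_apply, Matrix.single_apply, Finset.sum_ite_eq, ite_and]
  have e2 : (∑ l : Fin (N + 1), ∑ k : Fin (N + 1),
        (z ^ (l : ℕ) * (starRingEnd ℂ z) ^ (k : ℕ)) •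
          Matrix.single l k (((Real.sqrt (N.choose l) : ℝ) : ℂ) * (Real.sqrt (N.choose k) : ℝ))) l k
      = (z ^ (l : ℕ) * (starRingEnd ℂ z) ^ (k : ℕ)) *
        (((Real.sqrt (N.choose l) : ℝ) : ℂ) * (Real.sqrt (N.choose k) : ℝ)) := by
    simp [Matrix.sum_apply, Matrix.single_apply, ite_and]
  rw [e, Matrix.smul_apply, e2]
  change symPow N _ l 0 * symPow N (star (coherentRotation z : Matrix (Fin 2) (Fin 2) ℂ)) 0 k = _
  rw [symPow_apply_zero, symPow_zero_apply]
  simp only [coherentRotation, Matrix.star_apply]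
  simp
  simp only [← inv_pow]
  generalize ((Real.sqrt (1 + ‖z‖ ^ 2) : ℂ))⁻¹ = a
  have ha : a ^ (2 * N) = a ^ (N - l) * a ^ (l : ℕ) * (a ^ (N - k) * a ^ (k : ℕ)) := by
    rw [← pow_add, ← pow_add, ← pow_add]
    congr 1
    omega
  rw [ha, mul_pow, mul_pow]
  ring

/-! ### The derivative of the symmetric power representation -/

open Polynomial in
/-- Differentiation of a curve of polynomials, coefficient by coefficient, obeys the Leibniz rule. -/
theorem hasDerivAt_coeff_mul {P Q : ℂ → ℂ[X]} {P' Q' : ℂ[X]} {t : ℂ}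
    (hP : ∀ l, HasDerivAt (fun s => (P s).coeff l) (P'.coeff l) t)
    (hQ : ∀ l, HasDerivAt (fun s => (Q s).coeff l) (Q'.coeff l) t) (l : ℕ) :
    HasDerivAt (fun s => (P s * Q s).coeff l) ((P' * Q t + P t * Q').coeff l) t := by
  simp only [coeff_mul, coeff_add, ← Finset.sum_add_distrib]
  exact HasDerivAt.fun_sum fun x _ => (hP x.1).fun_mul (hQ x.2)

open Polynomial in
theorem hasDerivAt_coeff_pow {P : ℂ → ℂ[X]} {P' : ℂ[X]} {t : ℂ}
    (hP : ∀ l, HasDerivAt (fun s => (P s).coeff l) (P'.coeff l) t) (n l : ℕ) :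
    HasDerivAt (fun s => (P s ^ n).coeff l) ((n * P t ^ (n - 1) * P').coeff l) t := by
  induction n generalizing l with
  | zero => simpa using hasDerivAt_const t _
  | succ n ih =>
    have := hasDerivAt_coeff_mul ih hP l
    simp only [← pow_succ] at this
    convert this using 2
    rcases n with _ | n
    · simp
    · simp [pow_succ]; ring

/-- The derivative of the symmetric power representation at the identity, in the direction `Y`:
it sends the matrix units `e₁₂`, `e₂₁` to `J₊`, `J₋` and `e₁₁`, `e₂₂` to `N - k`, `k`. -/
def symDeriv (N : ℕ) : Matrix (Fin 2) (Fin 2) ℂ →ₗ[ℂ] SpinOp N where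
  toFun Y := Y 0 0 • Matrix.diagonal (fun k : Fin (N + 1) => (N : ℂ) - (k : ℕ)) + Y 0 1 • Jplus N +
    Y 1 0 • Jminus N + Y 1 1 • Matrix.diagonal fun k : Fin (N + 1) => ((k : ℕ) : ℂ)
  map_add' Y Z := by simp only [Matrix.add_apply]; module
  map_smul' c Y := by simp only [Matrix.smul_apply, smul_eq_mul, RingHom.id_apply]; module

theorem spin_mul_sub_magnetic_mul (N : ℕ) (k : Fin (N + 1)) :
    spin N * (spin N + 1) - magnetic N k * (magnetic N k + 1) = k * (N + 1 - k) := by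
  simp only [magnetic, spin]; ring

theorem Jplus_apply (N : ℕ) (a b : Fin (N + 1)) : Jplus N a b =
    if (a : ℕ) + 1 = b then ((Real.sqrt (b * (N + 1 - b)) : ℝ) : ℂ) else 0 := by
  simp [Jplus, spin_mul_sub_magnetic_mul]

theorem Jminus_apply (N : ℕ) (a b : Fin (N + 1)) : Jminus N a b =
    if (b : ℕ) + 1 = a then ((Real.sqrt (a * (N + 1 - a)) : ℝ) : ℂ) else 0 := by
  rw [Jminus, Matrix.conjTranspose_apply, Jplus_apply]
  split_ifs <;> simp

theorem choose_succ_mul_real {N a : ℕ} (h : a ≤ N) :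
    (N.choose (a + 1) : ℝ) * (a + 1) = N.choose a * (N - a) := by
  have := Nat.choose_succ_right_eq N a
  rw [← Nat.cast_sub h]
  exact_mod_cast this

theorem sqrt_choose_div_mul {N a : ℕ} (h : a ≤ N) :
    Real.sqrt (N.choose (a + 1)) / Real.sqrt (N.choose a) * (a + 1) =
      Real.sqrt ((a + 1) * (N - a)) := by
  have h0 : (0 : ℝ) < N.choose a := by exact_mod_cast Nat.choose_pos h
  have h1 : (0 : ℝ) ≤ N - a := sub_nonneg.2 (by exact_mod_cast h)
  rw [← Real.sqrt_div' _ h0.le, ← Real.sqrt_mul_self (show (0 : ℝ) ≤ a + 1 by positivity),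
    ← Real.sqrt_mul (by positivity), Real.sqrt_mul_self (by positivity)]
  congr 1
  field_simp
  linear_combination choose_succ_mul_real h

theorem sqrt_choose_div_mul' {N a : ℕ} (h : a < N) :
    Real.sqrt (N.choose a) / Real.sqrt (N.choose (a + 1)) * (N - a) =
      Real.sqrt ((a + 1) * (N - a)) := by
  have h0 : (0 : ℝ) < N.choose (a + 1) := by exact_mod_cast Nat.choose_pos h
  have h1 : (0 : ℝ) ≤ N - a := sub_nonneg.2 (by exact_mod_cast h.le)
  rw [← Real.sqrt_div' _ h0.le]
  have h2 : (N - a : ℝ) = Real.sqrt ((N - a) * (N - a)) := (Real.sqrt_mul_self h1).symm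
  rw [show Real.sqrt ((N.choose a : ℝ) / N.choose (a + 1)) * (N - a) =
    Real.sqrt ((N.choose a : ℝ) / N.choose (a + 1)) * Real.sqrt ((N - a) * (N - a)) by rw [← h2],
    ← Real.sqrt_mul (by positivity)]
  congr 1
  field_simp
  linear_combination (-(N - a : ℝ)) * choose_succ_mul_real h.le

open Polynomial in
/-- The derivative of `symImage N · k` at `U` in the direction `Z`. -/
def symTangent (N : ℕ) (U Z : Matrix (Fin 2) (Fin 2) ℂ) (k : ℕ) : ℂ[X] :=
  ((N - k : ℕ) : ℂ[X]) * (C (U 0 0) + C (U 1 0) * X) ^ (N - k - 1) * (C (Z 0 0) + C (Z 1 0) * X) *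
      (C (U 0 1) + C (U 1 1) * X) ^ k +
    (C (U 0 0) + C (U 1 0) * X) ^ (N - k) *
      ((k : ℂ[X]) * (C (U 0 1) + C (U 1 1) * X) ^ (k - 1) * (C (Z 0 1) + C (Z 1 1) * X))

open Polynomial in
theorem hasDerivAt_coeff_symImage (N : ℕ) (U Z : Matrix (Fin 2) (Fin 2) ℂ) (k l : ℕ) :
    HasDerivAt (fun t : ℂ => (symImage N (U + t • Z) k).coeff l)
      ((symTangent N U Z k).coeff l) 0 := by
  have key (j : Fin 2) (l : ℕ) : HasDerivAt (fun t : ℂ =>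
      (C ((U + t • Z) 0 j) + C ((U + t • Z) 1 j) * X).coeff l)
      ((C (Z 0 j) + C (Z 1 j) * X).coeff l) 0 := by
    have (i : Fin 2) (c : ℂ) : HasDerivAt (fun t : ℂ => (U i j + t * Z i j) * c) (Z i j * c) 0 := by
      simpa using (((hasDerivAt_id (0 : ℂ)).mul_const (Z i j)).const_add (U i j)).mul_const c
    have h := (this 0 ((1 : ℂ[X]).coeff l)).add (this 1 ((X : ℂ[X]).coeff l))
    have e (x y : ℂ) : (C x + C y * X).coeff l = x * (1 : ℂ[X]).coeff l + y * (X : ℂ[X]).coeff l := by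
      rw [coeff_add, ← mul_one (C x), coeff_C_mul, coeff_C_mul]
    simp only [e]
    exact h
  have h := hasDerivAt_coeff_mul (hasDerivAt_coeff_pow (key 0) (N - k))
    (hasDerivAt_coeff_pow (key 1) k) l
  simpa [symImage, symTangent] using h

open Polynomial in
theorem symTangent_one_coeff (N : ℕ) (Y : Matrix (Fin 2) (Fin 2) ℂ) (l k : Fin (N + 1)) :
    ((Real.sqrt (N.choose k) / Real.sqrt (N.choose l) : ℝ) : ℂ) * (symTangent N 1 Y k).coeff l =
      symDeriv N Y l k := by
  have hl : Real.sqrt (N.choose l) ≠ 0 :=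
    (Real.sqrt_pos.2 (by exact_mod_cast Nat.choose_pos (Nat.lt_succ_iff.1 l.2))).ne'
  obtain ⟨l, hlN⟩ := l
  obtain ⟨k, hkN⟩ := k
  have e : symTangent N 1 Y k = C (((N : ℂ) - k) * Y 0 0 + k * Y 1 1) * X ^ k +
      C (((N : ℂ) - k) * Y 1 0) * X ^ (k + 1) + C (k * Y 0 1) * X ^ (k - 1) := by
    simp only [symTangent, Matrix.one_apply_eq]
    rcases k with _ | k
    · simp; ring
    · rw [Nat.cast_sub (by omega)]; simp; ring
  rw [e]
  simp only [coeff_add, coeff_C_mul, coeff_X_pow, symDeriv, LinearMap.coe_mk, AddHom.coe_mk,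
    Matrix.add_apply, Matrix.smul_apply, Jplus_apply, Jminus_apply, Matrix.diagonal_apply,
    Fin.mk.injEq, smul_eq_mul]
  by_cases h1 : l + 1 = k
  · subst h1
    have h := sqrt_choose_div_mul (N := N) (a := l) (by omega)
    have h' := congrArg ((↑) : ℝ → ℂ) h
    push_cast at h' ⊢
    simp [show l ≠ l + 1 + 1 by omega, show l + 1 + 1 ≠ l by omega]
    linear_combination (Y 0 1) * h'
  by_cases h2 : k + 1 = l
  · subst h2
    have h := sqrt_choose_div_mul' (N := N) (a := k) (by omega)
    have h' := congrArg ((↑) : ℝ → ℂ) h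
    push_cast at h' ⊢
    simp [show k + 1 ≠ k - 1 by omega, show k + 1 + 1 ≠ k by omega]
    linear_combination (Y 1 0) * h'
  by_cases h3 : l = k
  · subst h3
    rcases l with _ | l
    · simp [mul_comm]
    · simp [hl]; ring
  · rcases k with _ | k
    · simp [h3, show l ≠ 1 by omega, show 1 ≠ l by omega]
    · simp [h3, show l ≠ k + 1 + 1 by omega, show k + 1 + 1 ≠ l by omega, show l ≠ k by omega]

theorem hasDerivAt_symPow (N : ℕ) (U Z : Matrix (Fin 2) (Fin 2) ℂ) (l k : Fin (N + 1)) :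
    HasDerivAt (fun t : ℂ => symPow N (U + t • Z) l k)
      (((Real.sqrt (N.choose k) / Real.sqrt (N.choose l) : ℝ) : ℂ) *
        (symTangent N U Z k).coeff l) 0 :=
  (hasDerivAt_coeff_symImage N U Z k l).const_mul _

/-- Differentiate `symPow U * symPow (1 + t Y) = symPow (U + t U Y)` at `t = 0`. -/
theorem symPow_mul_symDeriv (N : ℕ) (U Y : Matrix (Fin 2) (Fin 2) ℂ) (l k : Fin (N + 1)) :
    (symPow N U * symDeriv N Y) l k =
      ((Real.sqrt (N.choose k) / Real.sqrt (N.choose l) : ℝ) : ℂ) *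
        (symTangent N U (U * Y) k).coeff l := by
  have h1 := hasDerivAt_symPow N U (U * Y) l k
  have h2 : HasDerivAt (fun t : ℂ => ∑ i, symPow N U l i * symPow N (1 + t • Y) i k)
      (∑ i, symPow N U l i * symDeriv N Y i k) 0 :=
    HasDerivAt.fun_sum fun i _ => by
      rw [← symTangent_one_coeff]
      exact (hasDerivAt_symPow N 1 Y i k).const_mul _
  rw [Matrix.mul_apply]
  refine h2.unique (h1.congr_of_eventuallyEq (.of_forall fun t => ?_))
  simp only [← Matrix.mul_apply, ← symPow_mul]
  simp [mul_add]

/-- Differentiate `symPow (1 + t Y) * symPow U = symPow (U + t Y U)` at `t = 0`. -/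
theorem symDeriv_mul_symPow (N : ℕ) (U Y : Matrix (Fin 2) (Fin 2) ℂ) (l k : Fin (N + 1)) :
    (symDeriv N Y * symPow N U) l k =
      ((Real.sqrt (N.choose k) / Real.sqrt (N.choose l) : ℝ) : ℂ) *
        (symTangent N U (Y * U) k).coeff l := by
  have h1 := hasDerivAt_symPow N U (Y * U) l k
  have h2 : HasDerivAt (fun t : ℂ => ∑ i, symPow N (1 + t • Y) l i * symPow N U i k)
      (∑ i, symDeriv N Y l i * symPow N U i k) 0 :=
    HasDerivAt.fun_sum fun i _ => by
      rw [← symTangent_one_coeff]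
      exact (hasDerivAt_symPow N 1 Y l i).mul_const _
  rw [Matrix.mul_apply]
  refine h2.unique (h1.congr_of_eventuallyEq (.of_forall fun t => ?_))
  simp only [← Matrix.mul_apply, ← symPow_mul]
  simp [add_mul]

/-- The equivariance of the derivative: both sides are the derivative of the symmetric power at `U`
in the direction `U Y`. -/
theorem symPow_mul_symDeriv_eq (N : ℕ) {U V : Matrix (Fin 2) (Fin 2) ℂ} (h : V * U = 1)
    (Y : Matrix (Fin 2) (Fin 2) ℂ) :
    symPow N U * symDeriv N Y = symDeriv N (U * Y * V) * symPow N U := by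
  ext l k
  rw [symPow_mul_symDeriv, symDeriv_mul_symPow, mul_assoc (U * Y), h, mul_one]

/-! ### Covariance of `ζ` -/

theorem zetaMap_apply (N : ℕ) (ρ : SpinOp N) :
    zetaMap N ρ = (((1 / (spin N * (spin N + 1)) : ℝ)) : ℂ) •
      ((1 / 2 : ℂ) • (Jplus N * ρ * Jminus N + Jminus N * ρ * Jplus N) +
        Matrix.diagonal (fun k => (magnetic N k : ℂ)) * ρ *
          Matrix.diagonal fun k => (magnetic N k : ℂ)) := by
  simp only [zetaMap, angMom, LinearMap.smul_apply, Fin.sum_univ_three, LinearMap.add_apply,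
    LinearMap.comp_apply, LinearMap.mulLeft_apply, LinearMap.mulRight_apply, Matrix.cons_val_zero,
    Matrix.cons_val_one, Matrix.cons_val_two]
  simp only [← mul_assoc, Matrix.smul_mul, Matrix.mul_smul, smul_smul]
  have hI : (1 / (2 * Complex.I)) * (1 / (2 * Complex.I)) = -(1 / 4 : ℂ) := by
    have := Complex.I_mul_I
    field_simp
    norm_num
  rw [hI]
  simp only [mul_add, add_mul, mul_sub, sub_mul]
  congr 2
  module

/-- As `J_k = symDeriv N (σ_k / 2)` for the Pauli matrices `σ_k`, this is the identity
`∑ σ_k ⊗ σ_k = 2 ∑ e_ab ⊗ e_ba - 1 ⊗ 1`; `symDeriv` sends the identity matrix to `N`. -/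
theorem zetaMap_eq_symDeriv (N : ℕ) (ρ : SpinOp N) :
    zetaMap N ρ = (((1 / (spin N * (spin N + 1)) : ℝ)) : ℂ) •
      ((1 / 2 : ℂ) • ∑ a : Fin 2, ∑ b : Fin 2,
        symDeriv N (Matrix.single a b 1) * ρ * symDeriv N (Matrix.single b a 1) -
        ((N : ℂ) ^ 2 / 4) • ρ) := by
  rw [zetaMap_apply]
  congr 1
  have h : Matrix.diagonal (fun k => (magnetic N k : ℂ)) * ρ *
          Matrix.diagonal (fun k => (magnetic N k : ℂ)) =
      (1 / 2 : ℂ) • (Matrix.diagonal (fun k : Fin (N + 1) => (N : ℂ) - (k : ℕ)) * ρ *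
        Matrix.diagonal (fun k : Fin (N + 1) => (N : ℂ) - (k : ℕ)) +
        Matrix.diagonal (fun k : Fin (N + 1) => ((k : ℕ) : ℂ)) * ρ *
        Matrix.diagonal (fun k : Fin (N + 1) => ((k : ℕ) : ℂ))) - ((N : ℂ) ^ 2 / 4) • ρ := by
    ext l k
    simp [Matrix.mul_diagonal, Matrix.diagonal_mul, magnetic, spin]
    ring
  rw [h]
  simp [Fin.sum_univ_two, symDeriv]
  module

/-- The tensor `∑ e_ab ⊗ e_ba` is invariant under conjugation, the reason why `ζ` is covariant. -/
theorem sum_symDeriv_conj (N : ℕ) {U V : Matrix (Fin 2) (Fin 2) ℂ} (h : V * U = 1) (σ : SpinOp N) :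
    ∑ a : Fin 2, ∑ b : Fin 2, symDeriv N (U * Matrix.single a b 1 * V) * σ *
      symDeriv N (U * Matrix.single b a 1 * V) =
    ∑ a : Fin 2, ∑ b : Fin 2, symDeriv N (Matrix.single a b 1) * σ *
      symDeriv N (Matrix.single b a 1) := by
  have hUV : U * V = 1 := mul_eq_one_comm.1 h
  have e (a b : Fin 2) : U * Matrix.single a b 1 * V =
      ∑ c : Fin 2, ∑ d : Fin 2, (U c a * V b d) • Matrix.single c d 1 := by
    ext i j
    fin_cases i <;> fin_cases j <;>
      simp [Matrix.mul_apply, Matrix.sum_apply, Matrix.single_apply, ite_and]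
  have h00 : U 0 0 * V 0 0 + U 0 1 * V 1 0 = 1 := by
    simpa [Matrix.mul_apply, Fin.sum_univ_two] using congrFun (congrFun hUV 0) 0
  have h01 : U 0 0 * V 0 1 + U 0 1 * V 1 1 = 0 := by
    simpa [Matrix.mul_apply, Fin.sum_univ_two] using congrFun (congrFun hUV 0) 1
  have h10 : U 1 0 * V 0 0 + U 1 1 * V 1 0 = 0 := by
    simpa [Matrix.mul_apply, Fin.sum_univ_two] using congrFun (congrFun hUV 1) 0
  have h11 : U 1 0 * V 0 1 + U 1 1 * V 1 1 = 1 := by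
    simpa [Matrix.mul_apply, Fin.sum_univ_two] using congrFun (congrFun hUV 1) 1
  simp only [e, Fin.sum_univ_two, map_add, map_smul]
  generalize symDeriv N (Matrix.single 0 0 1) = A
  generalize symDeriv N (Matrix.single 0 1 1) = B
  generalize symDeriv N (Matrix.single 1 0 1) = C
  generalize symDeriv N (Matrix.single 1 1 1) = D
  simp only [add_mul, mul_add, Matrix.smul_mul, Matrix.mul_smul, smul_smul]
  match_scalars <;> grind

theorem isSU2Covariant_zetaMap (N : ℕ) : IsSU2Covariant N (zetaMap N) := by
  intro g ρ
  set U : Matrix (Fin 2) (Fin 2) ℂ := g.1 with hU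
  set V : Matrix (Fin 2) (Fin 2) ℂ := (g⁻¹ : SU2).1 with hV
  have hVU : V * U = 1 := congrArg Subtype.val (inv_mul_cancel g)
  have hUV : U * V = 1 := mul_eq_one_comm.1 hVU
  change zetaMap N (symPow N U * ρ * symPow N V) = symPow N U * zetaMap N ρ * symPow N V
  have e1 (Y) : symDeriv N (U * Y * V) * symPow N U = symPow N U * symDeriv N Y :=
    (symPow_mul_symDeriv_eq N hVU Y).symm
  have e2 (Y) : symPow N V * symDeriv N (U * Y * V) = symDeriv N Y * symPow N V := by
    rw [symPow_mul_symDeriv_eq N hUV]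
    congr 2
    rw [mul_assoc, mul_assoc, hVU, mul_one, ← mul_assoc, hVU, one_mul]
  rw [zetaMap_eq_symDeriv, zetaMap_eq_symDeriv, ← sum_symDeriv_conj N hVU]
  have e3 (Y Z) : symDeriv N (U * Y * V) * (symPow N U * ρ * symPow N V) *
      symDeriv N (U * Z * V) = symPow N U * (symDeriv N Y * ρ * symDeriv N Z) * symPow N V := by
    rw [← mul_assoc, ← mul_assoc, e1, mul_assoc _ _ (symDeriv N (U * Z * V)), e2]
    simp only [mul_assoc]
  simp only [e3]
  simp only [Fin.sum_univ_two, Matrix.smul_mul, Matrix.mul_smul, mul_add, add_mul, mul_sub, sub_mul]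

/-! ### The action of `ζ` on diagonal operators -/

/-- The projection `|j, m⟩⟨j, m|` with `m = j - k`; it is zero for `k > N`. -/
def basisProj (N k : ℕ) : SpinOp N := Matrix.diagonal fun i => if (i : ℕ) = k then 1 else 0

theorem mul_basisProj_mul_apply {N : ℕ} (A B : SpinOp N) (k a b : Fin (N + 1)) :
    (A * basisProj N k * B) a b = A a k * B k b := by
  rw [Matrix.mul_apply]
  simp [basisProj, Matrix.mul_diagonal, Fin.val_inj]

theorem basisProj_zero (N : ℕ) : basisProj N 0 = Matrix.single 0 0 1 := by
  ext a b
  rcases eq_or_ne a b with rfl | h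
  · simp [basisProj, Matrix.single_apply, eq_comm]
  · simp [basisProj, Matrix.single_apply, h]
    rintro rfl rfl
    exact h rfl

/-- On the diagonal, `ζ` is tridiagonal. For `k = 0` the truncated index `k - 1` is harmless, as its
coefficient vanishes. -/
theorem zetaMap_basisProj (N : ℕ) (k : Fin (N + 1)) :
    zetaMap N (basisProj N k) = ((1 / (spin N * (spin N + 1)) : ℝ) : ℂ) •
      (((k * (N + 1 - k) / 2 : ℝ) : ℂ) • basisProj N (k - 1) +
        ((magnetic N k ^ 2 : ℝ) : ℂ) • basisProj N k +
        (((k + 1) * (N - k) / 2 : ℝ) : ℂ) • basisProj N (k + 1)) := by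
  rw [zetaMap_apply]
  congr 1
  ext a b
  simp only [Matrix.add_apply, Matrix.smul_apply, mul_basisProj_mul_apply, Jplus_apply,
    Jminus_apply]
  simp only [basisProj, Matrix.diagonal_apply, smul_eq_mul, ← Fin.val_inj]
  obtain ⟨a, ha⟩ := a
  obtain ⟨b, hb⟩ := b
  obtain ⟨k, hk⟩ := k
  have hs (x : ℝ) (hx : 0 ≤ x) : ((Real.sqrt x : ℝ) : ℂ) * ((Real.sqrt x : ℝ) : ℂ) = x := by
    rw [← Complex.ofReal_mul, Real.mul_self_sqrt hx]
  have hkN : (k : ℝ) ≤ N := by exact_mod_cast Nat.lt_succ_iff.1 hk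
  have h1 := hs (k * (N + 1 - k)) (mul_nonneg (by positivity) (by linarith))
  have h2 := hs ((k + 1 : ℕ) * (N + 1 - (k + 1 : ℕ)))
    (mul_nonneg (by positivity) (by push_cast; linarith))
  dsimp only
  by_cases hab : a = b
  · subst hab
    by_cases e1 : a + 1 = k
    · subst e1
      simp [show ¬ a + 1 + 1 = a by omega, show ¬ a = a + 1 + 1 by omega] at h1 ⊢
      linear_combination (1 / 2) * h1
    by_cases e2 : k + 1 = a
    · subst e2
      simp [show ¬ k + 1 + 1 = k by omega, show ¬ k + 1 = k - 1 by omega] at h2 ⊢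
      linear_combination (1 / 2) * h2
    by_cases e3 : a = k
    · subst e3
      rcases a with _ | a
      · simp; ring
      · simp; ring
    · rcases k with _ | k
      · simp [show ¬ a = 1 by omega, show ¬ 1 = a by omega, e3, Ne.symm e3]
      · simp [show ¬ a = k by omega, show ¬ a = k + 1 + 1 by omega, show ¬ k + 1 + 1 = a by omega,
          e3, Ne.symm e3]
  · simp only [hab, if_false, mul_zero, add_zero]
    split_ifs <;> first | omega | simp

open Polynomial in
/-- Every `|j, m⟩⟨j, m|` is a real polynomial in `ζ` applied to `|j, j⟩⟨j, j|`: the tridiagonal action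
of `ζ` has nonzero entries below the diagonal, so one power of `ζ` reaches one more projection. -/
theorem exists_aeval_zetaMap_eq_basisProj (N k : ℕ) (hk : k ≤ N) :
    ∃ p : ℝ[X], p.natDegree ≤ k ∧
      aeval (zetaMap N) (p.map (algebraMap ℝ ℂ)) (basisProj N 0) = basisProj N k := by
  induction k using Nat.strong_induction_on with
  | _ k ih =>
  rcases k with _ | k
  · exact ⟨1, by simp, by simp⟩
  obtain ⟨p, hp, hp'⟩ := ih k (by omega) (by omega)
  obtain ⟨q, hq, hq'⟩ := ih (k - 1) (by omega) (by omega)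
  have hz := zetaMap_basisProj N ⟨k, by omega⟩
  set c : ℝ := 1 / (spin N * (spin N + 1)) with hc
  have hN : (0 : ℝ) < N := by exact_mod_cast (by omega : 0 < N)
  have hkN : (0 : ℝ) < N - k := sub_pos.2 (by exact_mod_cast (by omega : k < N))
  have hc0 : c ≠ 0 := by simp only [hc, spin]; positivity
  have hg : c * ((k + 1) * (N - k) / 2) ≠ 0 := mul_ne_zero hc0 (by positivity)
  simp only at hz
  generalize magnetic N ⟨k, by omega⟩ ^ 2 = m at hz
  generalize (k * (N + 1 - k) / 2 : ℝ) = α at hz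
  generalize ((k + 1) * (N - k) / 2 : ℝ) = γ at hz hg
  refine ⟨C (c * γ)⁻¹ * (X * p - C (c * α) * q - C (c * m) * p), ?_, ?_⟩
  · have h1 := natDegree_mul_le_of_le natDegree_X_le hp
    have h2 := natDegree_C_mul_le (c * α) q
    have h3 := natDegree_C_mul_le (c * m) p
    have h4 := natDegree_sub_le (X * p) (C (c * α) * q)
    have h5 := natDegree_sub_le (X * p - C (c * α) * q) (C (c * m) * p)
    have h6 := natDegree_C_mul_le (c * γ)⁻¹ (X * p - C (c * α) * q - C (c * m) * p)
    omega
  · have hcC : (c : ℂ) ≠ 0 := Complex.ofReal_ne_zero.2 hc0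
    have hgC : (γ : ℂ) ≠ 0 := Complex.ofReal_ne_zero.2 (right_ne_zero_of_mul hg)
    simp only [Polynomial.map_mul, Polynomial.map_sub, map_C, map_X, map_mul, map_sub, aeval_C,
      aeval_X, Module.End.mul_apply, LinearMap.sub_apply, hp', hq', hz,
      Module.algebraMap_end_apply]
    simp only [Complex.coe_algebraMap]
    push_cast
    match_scalars <;> field_simp <;> ring

/-! ### Covariant maps are determined by their value at one projection -/

theorem IsSU2Covariant.sub {N : ℕ} {ξ η : Module.End ℂ (SpinOp N)} (hξ : IsSU2Covariant N ξ)
    (hη : IsSU2Covariant N η) : IsSU2Covariant N (ξ - η) := fun g ρ => by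
  simp [hξ g ρ, hη g ρ, mul_sub, sub_mul]

theorem IsSU2Covariant.pow {N : ℕ} {ξ : Module.End ℂ (SpinOp N)} (hξ : IsSU2Covariant N ξ)
    (n : ℕ) : IsSU2Covariant N (ξ ^ n) := fun g ρ => by
  induction n with
  | zero => simp
  | succ n ih => rw [pow_succ', Module.End.mul_apply, ih, hξ, Module.End.mul_apply]

theorem IsSU2Covariant.sum_smul {N : ℕ} {ι : Type*} (s : Finset ι) (q : ι → ℂ)
    {ξ : ι → Module.End ℂ (SpinOp N)} (hξ : ∀ i, IsSU2Covariant N (ξ i)) :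
    IsSU2Covariant N (∑ i ∈ s, q i • ξ i) := fun g ρ => by
  simp only [LinearMap.sum_apply, LinearMap.smul_apply, hξ _ g ρ, Finset.mul_sum, Finset.sum_mul,
    Matrix.mul_smul, Matrix.smul_mul]

/-- The projection `|j, j⟩⟨j, j|` is cyclic: its conjugates, the coherent states, span all
operators. -/
theorem IsSU2Covariant.eq_zero {N : ℕ} {η : Module.End ℂ (SpinOp N)} (hη : IsSU2Covariant N η)
    (h0 : η (Matrix.single 0 0 1) = 0) : η = 0 := by
  have hE (l k : Fin (N + 1)) : η (Matrix.single l k 1) = 0 := by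
    ext i j
    have := eq_zero_of_forall_sum_mul_pow_mul_conj_pow_eq_zero (fun l k : Fin (N + 1) =>
      η (Matrix.single l k (((Real.sqrt (N.choose l) : ℝ) : ℂ) * (Real.sqrt (N.choose k) : ℝ))) i j)
      (fun z => ?_) l k
    · rw [← mul_one ((_ : ℂ) * _), ← smul_eq_mul (_ * _), ← Matrix.smul_single, map_smul] at this
      exact (mul_eq_zero.1 this).resolve_left
        (mul_ne_zero (sqrt_choose_ne_zero l) (sqrt_choose_ne_zero k))
    · have h := hη (coherentRotation z) (Matrix.single 0 0 1)
      rw [spinRep_coherentRotation_conj_single, h0, mul_zero, zero_mul, map_smul] at h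
      have hne : ((Real.sqrt (1 + ‖z‖ ^ 2) : ℝ) : ℂ)⁻¹ ^ (2 * N) ≠ 0 :=
        pow_ne_zero _ (inv_ne_zero (Complex.ofReal_ne_zero.2
          (Real.sqrt_pos.2 (by positivity)).ne'))
      have h := congrFun (congrFun ((smul_eq_zero.1 h).resolve_left hne) i) j
      simp only [map_sum, map_smul, Matrix.sum_apply, Matrix.smul_apply, smul_eq_mul,
        Matrix.zero_apply] at h
      simpa only [mul_comm] using h
  refine Matrix.ext_linearMap _ fun l k => ?_
  ext1
  simpa using hE l k

/-! ### Invariance under rotations about the `z` axis -/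

open Polynomial in
theorem symPow_diagonal (N : ℕ) (a d : ℂ) : symPow N !![a, 0; 0, d] =
    Matrix.diagonal fun k : Fin (N + 1) => a ^ (N - k) * d ^ (k : ℕ) := by
  ext l k
  have hne := sqrt_choose_ne_zero k
  have e : symImage N !![a, 0; 0, d] k = C (a ^ (N - k) * d ^ (k : ℕ)) * X ^ (k : ℕ) := by
    simp [symImage, mul_pow, mul_assoc]
  rw [symPow, Matrix.of_apply, e, coeff_C_mul, coeff_X_pow, Matrix.diagonal_apply]
  rcases eq_or_ne l k with rfl | h
  · simp [hne]
  · simp [h, Fin.val_inj]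

/-- The rotation about the `z` axis with eigenvalues `e^{iθ}` and `e^{-iθ}` on `ℂ²`. -/
def zRotation (θ : ℝ) : SU2 :=
  ⟨!![Complex.exp (θ * Complex.I), 0; 0, Complex.exp (-(θ * Complex.I))], by
    have hc : (starRingEnd ℂ) (Complex.exp (θ * Complex.I)) = Complex.exp (-(θ * Complex.I)) := by
      rw [← Complex.exp_conj]; simp
    have hc' : (starRingEnd ℂ) (Complex.exp (-(θ * Complex.I))) = Complex.exp (θ * Complex.I) := by
      rw [← Complex.exp_conj]; simp
    rw [Matrix.mem_specialUnitaryGroup_iff, Matrix.mem_unitaryGroup_iff]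
    constructor
    · ext i j
      fin_cases i <;> fin_cases j <;>
        simp [Matrix.mul_apply, Fin.sum_univ_two, Matrix.star_apply, hc, hc', ← Complex.exp_add]
    · simp [Matrix.det_fin_two, ← Complex.exp_add]⟩

theorem spinRep_zRotation (N : ℕ) (θ : ℝ) : spinRep N (zRotation θ) =
    Matrix.diagonal fun k : Fin (N + 1) => Complex.exp ((((N : ℂ) - 2 * (k : ℕ)) * θ) * Complex.I) := by
  change symPow N !![_, 0; 0, _] = _
  rw [symPow_diagonal]
  congr 1
  ext k
  rw [← Complex.exp_nat_mul, ← Complex.exp_nat_mul, ← Complex.exp_add,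
    Nat.cast_sub (Nat.lt_succ_iff.1 k.2)]
  congr 1
  ring

/-- Rotations about the `z` axis fix `|j, j⟩⟨j, j|`, hence also its image, which is then diagonal. -/
theorem IsSU2Covariant.apply_single_offDiag {N : ℕ} {ξ : Module.End ℂ (SpinOp N)}
    (hξ : IsSU2Covariant N ξ) {l k : Fin (N + 1)} (hlk : l ≠ k) :
    ξ (Matrix.single 0 0 1) l k = 0 := by
  have hne : ((l : ℕ) : ℂ) - (k : ℕ) ≠ 0 := sub_ne_zero.2 fun h => hlk (Fin.ext (by exact_mod_cast h))
  -- The phases of `R` at `l` and `k` then differ by the factor `-1`.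
  set θ : ℝ := Real.pi / (2 * (((k : ℕ) : ℝ) - (l : ℕ))) with hθ
  set R := spinRep N (zRotation θ) with hR
  set S := spinRep N (zRotation θ)⁻¹ with hS
  have hSR : S * R = 1 := by rw [hS, hR, ← map_mul, inv_mul_cancel, map_one]
  have hfix : R * (Matrix.single 0 0 1 : SpinOp N) * S = Matrix.single 0 0 1 := by
    have : R * (Matrix.single 0 0 1 : SpinOp N) = Matrix.single 0 0 1 * R := by
      rw [hR, spinRep_zRotation]
      ext i j
      rw [Matrix.diagonal_mul, Matrix.mul_diagonal, Matrix.single_apply]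
      split_ifs with h
      · rw [← h.1, ← h.2, mul_comm]
      · simp
    rw [this, mul_assoc, mul_eq_one_comm.1 hSR, mul_one]
  have h := hξ (zRotation θ) (Matrix.single 0 0 1)
  rw [← hR, ← hS, hfix] at h
  have h := congrArg (· * R) h
  simp only [mul_assoc, hSR, mul_one] at h
  have h := congrFun (congrFun h l) k
  rw [hR, spinRep_zRotation, Matrix.mul_diagonal, Matrix.diagonal_mul] at h
  have hphase : Complex.exp ((((N : ℂ) - 2 * (l : ℕ)) * θ) * Complex.I) =
      -Complex.exp ((((N : ℂ) - 2 * (k : ℕ)) * θ) * Complex.I) := by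
    have : (((N : ℂ) - 2 * (l : ℕ)) * θ) * Complex.I =
        (((N : ℂ) - 2 * (k : ℕ)) * θ) * Complex.I + Real.pi * Complex.I := by
      have hne' : ((k : ℕ) : ℂ) - (l : ℕ) ≠ 0 := fun h => hne (by linear_combination -h)
      rw [hθ]
      push_cast
      field_simp
      ring
    rw [this, Complex.exp_add, Complex.exp_pi_mul_I, mul_neg_one]
  rw [hphase] at h
  have h2 : 2 * (ξ (Matrix.single 0 0 1) l k *
      Complex.exp ((((N : ℂ) - 2 * (k : ℕ)) * θ) * Complex.I)) = 0 := by
    linear_combination h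
  simpa [Complex.exp_ne_zero] using h2

/-! ### The expansion in powers of `ζ` -/

/-- The coefficients are real linear combinations of the diagonal entries of `ξ(|j, j⟩⟨j, j|)`,
with weights that do not depend on `ξ`. -/
theorem exists_eq_sum_zetaMap_pow (N : ℕ) : ∃ c : Fin (N + 1) → Fin (N + 1) → ℝ,
    ∀ ξ : Module.End ℂ (SpinOp N), IsSU2Covariant N ξ → ξ = ∑ n : Fin (N + 1),
      (∑ k, ξ (Matrix.single 0 0 1) k k * (c k n : ℂ)) • zetaMap N ^ (n : ℕ) := by
  choose p hp hp' using fun k : Fin (N + 1) =>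
    exists_aeval_zetaMap_eq_basisProj N k (Nat.lt_succ_iff.1 k.2)
  refine ⟨fun k n => (p k).coeff n, fun ξ hξ => ?_⟩
  rw [← sub_eq_zero]
  refine (hξ.sub (.sum_smul Finset.univ _ (ξ := fun n : Fin (N + 1) => zetaMap N ^ (n : ℕ))
    fun n => (isSU2Covariant_zetaMap N).pow n)).eq_zero ?_
  rw [LinearMap.sub_apply, sub_eq_zero]
  have hdiag : ξ (Matrix.single 0 0 1) =
      ∑ k : Fin (N + 1), ξ (Matrix.single 0 0 1) k k • basisProj N k := by
    ext l k
    rcases eq_or_ne l k with rfl | h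
    · simp [Matrix.sum_apply, basisProj, Fin.val_inj]
    · simp [Matrix.sum_apply, basisProj, h, hξ.apply_single_offDiag h]
  have hpk (k : Fin (N + 1)) : basisProj N k = ∑ n : Fin (N + 1),
      ((p k).coeff n : ℂ) • (zetaMap N ^ (n : ℕ)) (Matrix.single 0 0 1) := by
    rw [← hp' k, basisProj_zero, Polynomial.aeval_eq_sum_range' (n := N + 1), LinearMap.sum_apply,
      ← Fin.sum_univ_eq_sum_range (fun n => (((p k).map (algebraMap ℝ ℂ)).coeff n •
        zetaMap N ^ n) (Matrix.single 0 0 1))]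
    · simp
    · exact Polynomial.natDegree_map_le.trans_lt ((hp k).trans_lt k.2)
  conv_lhs => rw [hdiag]
  simp only [hpk, LinearMap.sum_apply, LinearMap.smul_apply, Finset.smul_sum, Finset.sum_smul,
    smul_smul]
  exact Finset.sum_comm

theorem isDensityMatrix_single (N : ℕ) : IsDensityMatrix (Matrix.single 0 0 1 : SpinOp N) := by
  constructor
  · rw [← Matrix.diagonal_single]
    refine Matrix.PosSemidef.diagonal fun i => ?_
    by_cases h : i = 0 <;> simp [h]
  · simp

theorem theorem1 (N : ℕ) (ξ : Module.End ℂ (SpinOp N)) (hξ : IsSU2Covariant N ξ) :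
    (∃ q : Fin (N + 1) → ℂ, ξ = ∑ n : Fin (N + 1), q n • zetaMap N ^ (n : ℕ)) ∧
    ((∀ ρ : SpinOp N, IsDensityMatrix ρ → (ξ ρ).IsHermitian) →
      ∃ q : Fin (N + 1) → ℝ, ξ = ∑ n : Fin (N + 1), (q n : ℂ) • zetaMap N ^ (n : ℕ)) := by
  obtain ⟨c, hc⟩ := exists_eq_sum_zetaMap_pow N
  have h := hc ξ hξ
  refine ⟨⟨_, h⟩, fun hH => ⟨fun n => ∑ k, (ξ (Matrix.single 0 0 1) k k).re * c k n, ?_⟩⟩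
  have hre (k : Fin (N + 1)) : ((ξ (Matrix.single 0 0 1) k k).re : ℂ) =
      ξ (Matrix.single 0 0 1) k k :=
    (hH _ (isDensityMatrix_single N)).coe_re_apply_self k
  conv_lhs => rw [h]
  simp only [Complex.ofReal_sum, Complex.ofReal_mul, hre]

end
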